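/- Formulas are built from propositional variables with the connectives $\land,\lor,\to,\bot,\Box$. A sequent $\Gamma\Rightarrow\Delta$ is a pair of finite multisets of formulas. The sequent calculus $\mathbf{S5}$ has the initial sequents $x\Rightarrow x$ ($x$ a variable), the structural rules - weakening: from $\Gamma\Rightarrow\Delta$ infer $\Gamma,\Gamma'\Rightarrow\Delta,\Delta'$; - contraction: from $\Gamma\Rightarrow\Delta$ infer $\Gamma^*\Rightarrow\Delta^*$, where $\Gamma^*,\Delta^*$ are submultisets of $\Gamma,\Delta$ with the same supports; - multicut: from $\Gamma\Rightarrow\Delta,C^p$ and $C^q,\Gamma'\Rightarrow\Delta'$ infer $\Gamma,\Gamma'\Rightarrow\Delta,\Delta'$, where $C^p$ and $C^q$ denote $p\ge 1$ and $q\ge 1$ copies of the cut formula $C$; and the following logical rules (those of the classical calculus $\mathbf{LK}$, and $(T)$ and $(5)$ for $\Box$): - $(\bot\mathtt l)$: infer $\Gamma,\bot\Rightarrow\Delta$ from no premise; $(\bot\mathtt r)$: from $\Gamma\Rightarrow\Delta$ infer $\Gamma\Rightarrow\bot,\Delta$; - $(\land\mathtt l)$: from $\Gamma,A,B\Rightarrow\Delta$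 infer $\Gamma,A\land B\Rightarrow\Delta$; $(\land\mathtt r)$: from $\Gamma\Rightarrow A,\Delta$ and $\Gamma\Rightarrow B,\Delta$ infer $\Gamma\Rightarrow A\land B,\Delta$; - $(\lor\mathtt l)$: from $\Gamma,A\Rightarrow\Delta$ and $\Gamma,B\Rightarrow\Delta$ infer $\Gamma,A\lor B\Rightarrow\Delta$; $(\lor\mathtt r)$: from $\Gamma\Rightarrow A,B,\Delta$ infer $\Gamma\Rightarrow A\lor B,\Delta$; - $(\to\mathtt l)$: from $\Gamma\Rightarrow A,\Delta$ and $\Gamma,B\Rightarrow\Delta$ infer $\Gamma,A\to B\Rightarrow\Delta$; $(\to\mathtt r)$: from $\Gamma,A\Rightarrow B,\Delta$ infer $\Gamma\Rightarrow A\to B,\Delta$; - $(T)$: from $\Gamma,A\Rightarrow\Delta$ infer $\Gamma,\Box A\Rightarrow\Delta$; - $(5)$: from $\Gamma\Rightarrow A,\Delta$ infer $\Gamma\Rightarrow\Box A,\Delta$, provided every formula in $\Gamma$ and $\Delta$ has the form $\Box B$. A proof of a sequent is a finite tree of instances of these rules, with that sequent at the root, all of whose leaves are initial sequents or instances of $(\bot\mathtt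 l)$. An instance of multicut is analytic if its cut formula is a subformula of some formula in its conclusion (every formula being a subformula of itself). A proof is locally analytic if all its instances of multicut are analytic. **Corollary.** $\mathbf{S5}$ has the analytic cut property: every sequent provable in $\mathbf{S5}$ has a locally analytic proof in $\mathbf{S5}$. -/

import Mathlib

namespace S5

/-- Formulas over the variables `V` and the connectives `∧, ∨, →, ⊥, □`. -/
inductive Formula (V : Type*) where
  | var (x : V)
  | bot
  | and (A B : Formula V)
  | or (A B : Formula V)
  | imp (A B : Formula V)
  | box (A : Formula V)

/-- The set of subformulas of a formula (the formula itself included). -/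
def Formula.subformulas {V : Type*} : Formula V → Set (Formula V)
  | .var x => {.var x}
  | .bot => {.bot}
  | .and A B => {.and A B} ∪ (A.subformulas ∪ B.subformulas)
  | .or A B => {.or A B} ∪ (A.subformulas ∪ B.subformulas)
  | .imp A B => {.imp A B} ∪ (A.subformulas ∪ B.subformulas)
  | .box A => {.box A} ∪ A.subformulas

/-- Labelled formulas: `l A` is an occurrence of `A` in the antecedent of a sequent,
`r A` an occurrence in the succedent. -/
inductive LFormula (V : Type*) where
  | l (A : Formula V)
  | r (A : Formula V)

/-- The formula obtained by forgetting the label. -/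
def LFormula.formula {V : Type*} : LFormula V → Formula V
  | .l A => A
  | .r A => A

/-- The sequent `A₁, …, Aₙ ⇒ B₁, …, Bₘ` is the finite multiset
`{l A₁, …, l Aₙ, r B₁, …, r Bₘ}` of labelled formulas. -/
abbrev Sequent (V : Type*) := Multiset (LFormula V)

/-- `Γ'` is a contraction of `Γ`: it is a submultiset of `Γ` with the same support. -/
def IsContraction {V : Type*} (Γ' Γ : Sequent V) : Prop :=
  Γ' ≤ Γ ∧ ∀ X, X ∈ Γ' ↔ X ∈ Γ

/-- Every formula of `Γ`, on either side, is boxed: the context restriction of rule (5). -/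
def Boxed {V : Type*} (Γ : Sequent V) : Prop :=
  ∀ X ∈ Γ, ∃ A : Formula V, X.formula = .box A

open LFormula in
/-- `Proof Γ` is the type of proof trees with endsequent `Γ` in the calculus **S5**: initial
sequents on variables, weakening, contraction, multicut, the logical rules of **LK**, and the rules
(T) and (5) for `□`. -/
inductive Proof {V : Type*} : Sequent V → Type _ where
  | id (x : V) : Proof {l (.var x), r (.var x)}
  | weak (Γ Δ : Sequent V) : Proof Γ → Proof (Γ + Δ)
  | contr (Γ Γ' : Sequent V) (h : IsContraction Γ' Γ) : Proof Γ → Proof Γ'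
  | mcut (Γ Δ : Sequent V) (C : Formula V) (p q : ℕ) (hp : p ≠ 0) (hq : q ≠ 0) :
      Proof (Γ + Multiset.replicate p (r C)) → Proof (Δ + Multiset.replicate q (l C)) →
      Proof (Γ + Δ)
  | botL (Γ : Sequent V) : Proof (Γ + {l .bot})
  | botR (Γ : Sequent V) : Proof Γ → Proof (Γ + {r .bot})
  | andL (Γ : Sequent V) (A B : Formula V) :
      Proof (Γ + {l A, l B}) → Proof (Γ + {l (.and A B)})
  | andR (Γ : Sequent V) (A B : Formula V) :
      Proof (Γ + {r A}) → Proof (Γ + {r B}) → Proof (Γ + {r (.and A B)})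
  | orL (Γ : Sequent V) (A B : Formula V) :
      Proof (Γ + {l A}) → Proof (Γ + {l B}) → Proof (Γ + {l (.or A B)})
  | orR (Γ : Sequent V) (A B : Formula V) :
      Proof (Γ + {r A, r B}) → Proof (Γ + {r (.or A B)})
  | impL (Γ : Sequent V) (A B : Formula V) :
      Proof (Γ + {r A}) → Proof (Γ + {l B}) → Proof (Γ + {l (.imp A B)})
  | impR (Γ : Sequent V) (A B : Formula V) :
      Proof (Γ + {l A, r B}) → Proof (Γ + {r (.imp A B)})
  | ruleT (Γ : Sequent V) (A : Formula V) :
      Proof (Γ + {l A}) → Proof (Γ + {l (.box A)})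
  | rule5 (Γ : Sequent V) (A : Formula V) (hΓ : Boxed Γ) :
      Proof (Γ + {r A}) → Proof (Γ + {r (.box A)})

/-- `Γ` is provable, with arbitrary cuts allowed. -/
def Provable {V : Type*} (Γ : Sequent V) : Prop := Nonempty (Proof Γ)

/-- A cut with cut formula `C` and conclusion `Γ` is analytic if `C` is a subformula of some formula
of `Γ`. -/
def IsAnalyticCut {V : Type*} (C : Formula V) (Γ : Sequent V) : Prop :=
  ∃ X ∈ Γ, C ∈ X.formula.subformulas

/-- A proof is locally analytic if every instance of multicut in it is analytic. -/
def Proof.LocallyAnalytic {V : Type*} {Γ : Sequent V} : Proof Γ → Prop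
  | .id _ => True
  | .weak _ _ π => π.LocallyAnalytic
  | .contr _ _ _ π => π.LocallyAnalytic
  | .mcut Γ Δ C _ _ _ _ π ρ =>
      IsAnalyticCut C (Γ + Δ) ∧ π.LocallyAnalytic ∧ ρ.LocallyAnalytic
  | .botL _ => True
  | .botR _ π => π.LocallyAnalytic
  | .andL _ _ _ π => π.LocallyAnalytic
  | .andR _ _ _ π ρ => π.LocallyAnalytic ∧ ρ.LocallyAnalytic
  | .orL _ _ _ π ρ => π.LocallyAnalytic ∧ ρ.LocallyAnalytic
  | .orR _ _ _ π => π.LocallyAnalytic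
  | .impL _ _ _ π ρ => π.LocallyAnalytic ∧ ρ.LocallyAnalytic
  | .impR _ _ _ π => π.LocallyAnalytic
  | .ruleT _ _ π => π.LocallyAnalytic
  | .rule5 _ _ _ π => π.LocallyAnalytic

/-- The analytic cut property of **S5** over the variables `V`: every provable sequent has a
locally analytic proof. -/
def AnalyticCutProperty (V : Type*) : Prop :=
  ∀ Γ : Sequent V, Provable Γ → ∃ π : Proof Γ, π.LocallyAnalytic

end S5

namespace S5

open LFormula

variable {V : Type*}

/-! ### Subformulas -/

/-! The argument is semantic: proofs with arbitrary cuts are sound for Kripke models with total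
accessibility (`Proof.sound`), and locally analytic proofs are already complete for them. A sequent
without a locally analytic proof extends to a saturated one (`exists_saturated`), where each
subformula is placed on one side; only cuts on subformulas are needed. The saturated sequents with
the same boxed formulas are the worlds of a model. In it every antecedent formula of a world is true
there and every succedent formula false (`World.truth`); the worlds refuting a succedent box come
from rule (5) (`Saturated.exists_box_witness`). So the sequent is refuted and has no proof at all.
-/

theorem Formula.mem_subformulas_self (A : Formula V) : A ∈ A.subformulas := by
  cases A <;> simp [Formula.subformulas]

theorem Formula.subformulas_trans {A B C : Formula V} (hAB : A ∈ B.subformulas)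
    (hBC : B ∈ C.subformulas) : A ∈ C.subformulas := by
  induction C with
  | var x => simp only [Formula.subformulas, Set.mem_singleton_iff] at hBC; subst hBC; exact hAB
  | bot => simp only [Formula.subformulas, Set.mem_singleton_iff] at hBC; subst hBC; exact hAB
  | and C D ihC ihD | or C D ihC ihD | imp C D ihC ihD =>
    rcases hBC with hBC | hBC | hBC
    · rw [Set.mem_singleton_iff] at hBC; subst hBC; exact hAB
    · exact Or.inr (Or.inl (ihC hBC))
    · exact Or.inr (Or.inr (ihD hBC))
  | box C ihC =>
    rcases hBC with hBC | hBC
    · rw [Set.mem_singleton_iff] at hBC; subst hBC; exact hAB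
    · exact Or.inr (ihC hBC)

theorem Formula.finite_subformulas (A : Formula V) : A.subformulas.Finite := by
  induction A with
  | var x => exact Set.finite_singleton _
  | bot => exact Set.finite_singleton _
  | and A B ihA ihB | or A B ihA ihB | imp A B ihA ihB =>
    exact (Set.finite_singleton _).union (ihA.union ihB)
  | box A ihA => exact (Set.finite_singleton _).union ihA

/-- The subformulas of the formulas of a sequent. -/
def subformulasOf (Γ : Sequent V) : Set (Formula V) :=
  {C | ∃ X ∈ Γ, C ∈ X.formula.subformulas}

theorem finite_subformulasOf (Γ : Sequent V) : (subformulasOf Γ).Finite := by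
  have h : subformulasOf Γ = ⋃ X ∈ {X | X ∈ Γ}, X.formula.subformulas := by
    ext; simp [subformulasOf]
  rw [h]
  exact (Multiset.finite_toSet Γ).biUnion fun X _ => X.formula.finite_subformulas

theorem subformulasOf_of_mem {A C : Formula V} {Γ : Sequent V} (hA : A ∈ subformulasOf Γ)
    (hC : C ∈ A.subformulas) : C ∈ subformulasOf Γ := by
  obtain ⟨X, hX, h⟩ := hA
  exact ⟨X, hX, Formula.subformulas_trans hC h⟩

/-! ### Semantics: Kripke models with the total accessibility relation -/

/-- Truth of a formula at a world of a model whose accessibility relation is total. -/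
def Forces {W : Type*} (val : W → V → Prop) : W → Formula V → Prop
  | w, .var x => val w x
  | _, .bot => False
  | w, .and A B => Forces val w A ∧ Forces val w B
  | w, .or A B => Forces val w A ∨ Forces val w B
  | w, .imp A B => Forces val w A → Forces val w B
  | _, .box A => ∀ v, Forces val v A

/-- A labelled formula holds if it is a false antecedent or a true succedent formula. -/
def LFormula.Holds {W : Type*} (val : W → V → Prop) (w : W) : LFormula V → Prop
  | .l A => ¬ Forces val w A
  | .r A => Forces val w A

theorem LFormula.holds_l {W : Type*} (val : W → V → Prop) (w : W) (A : Formula V) :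
    (l A).Holds val w ↔ ¬ Forces val w A := Iff.rfl

theorem LFormula.holds_r {W : Type*} (val : W → V → Prop) (w : W) (A : Formula V) :
    (r A).Holds val w ↔ Forces val w A := Iff.rfl

theorem LFormula.holds_iff_of_boxed {W : Type*} (val : W → V → Prop) (w v : W) {X : LFormula V}
    (hX : ∃ A : Formula V, X.formula = .box A) : X.Holds val w ↔ X.Holds val v := by
  obtain ⟨A, hA⟩ := hX
  cases X <;> simp only [LFormula.formula] at hA <;> subst hA <;> rfl

theorem Proof.sound {W : Type*} (val : W → V → Prop) {Γ : Sequent V} (π : Proof Γ) (w : W) :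
    ∃ X ∈ Γ, X.Holds val w := by
  induction π generalizing w with
  | id x =>
    by_cases h : val w x
    · exact ⟨r (.var x), by simp, h⟩
    · exact ⟨l (.var x), by simp, h⟩
  | weak Γ Δ _ ih =>
    obtain ⟨X, hX, h⟩ := ih w
    exact ⟨X, Multiset.mem_add.2 (Or.inl hX), h⟩
  | contr Γ Γ' hc _ ih =>
    obtain ⟨X, hX, h⟩ := ih w
    exact ⟨X, (hc.2 X).2 hX, h⟩
  | mcut Γ Δ C p q _ _ _ _ ih₁ ih₂ =>
    obtain ⟨X, hX, h⟩ := ih₁ w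
    obtain ⟨Y, hY, h'⟩ := ih₂ w
    rcases Multiset.mem_add.1 hX with hX | hX
    · exact ⟨X, Multiset.mem_add.2 (Or.inl hX), h⟩
    rcases Multiset.mem_add.1 hY with hY | hY
    · exact ⟨Y, Multiset.mem_add.2 (Or.inr hY), h'⟩
    rw [Multiset.eq_of_mem_replicate hX] at h
    rw [Multiset.eq_of_mem_replicate hY] at h'
    exact absurd h h'
  | botL Γ => exact ⟨l .bot, by simp, fun h => h⟩
  | rule5 Γ A hΓ _ ih =>
    -- The truth of a boxed formula does not depend on the world, so a context that fails at `w`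
    -- fails everywhere, and the premise then gives `A` at every world.
    by_cases h : ∃ X ∈ Γ, X.Holds val w
    · obtain ⟨X, hX, h⟩ := h
      exact ⟨X, Multiset.mem_add.2 (Or.inl hX), h⟩
    · refine ⟨r (.box A), by simp, fun v => ?_⟩
      obtain ⟨X, hX, h'⟩ := ih v
      rcases Multiset.mem_add.1 hX with hX | hX
      · exact absurd ⟨X, hX, (holds_iff_of_boxed val w v (hΓ X hX)).2 h'⟩ h
      · rw [Multiset.mem_singleton.1 hX] at h'
        exact h'
  | ruleT Γ A _ ih =>
    have := ih w
    simp only [Multiset.mem_add, Multiset.mem_singleton, or_and_right, exists_or,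
      exists_eq_left] at this ⊢
    exact this.imp_right fun h h' => h (h' w)
  | botR _ _ ih | andL _ _ _ _ ih | orR _ _ _ _ ih | impR _ _ _ _ ih =>
    have := ih w
    simp only [Multiset.mem_add, Multiset.insert_eq_cons, Multiset.mem_cons,
      Multiset.mem_singleton, or_and_right, exists_or, exists_eq_left, holds_l, holds_r,
      Forces] at this ⊢
    grind
  | andR _ _ _ _ _ ih₁ ih₂ | orL _ _ _ _ _ ih₁ ih₂ | impL _ _ _ _ _ ih₁ ih₂ =>
    have h₁ := ih₁ w
    have h₂ := ih₂ w
    simp only [Multiset.mem_add, Multiset.mem_singleton, or_and_right, exists_or,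
      exists_eq_left, holds_l, holds_r, Forces] at h₁ h₂ ⊢
    grind

/-! ### Locally analytic provability -/

/-- The sequent `Γ` has a locally analytic proof. -/
def AnalyticallyProvable (Γ : Sequent V) : Prop := ∃ π : Proof Γ, π.LocallyAnalytic

namespace AnalyticallyProvable

/-- Weaken by `Δ`, then contract. Hence only supports matter, and sequents may be handled as sets
below. -/
theorem mono {Γ Δ : Sequent V} (h : AnalyticallyProvable Γ) (hsub : ∀ X ∈ Γ, X ∈ Δ) :
    AnalyticallyProvable Δ := by
  obtain ⟨π, hπ⟩ := h
  have hc : IsContraction Δ (Γ + Δ) := by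
    refine ⟨Multiset.le_add_left _ _, fun X => ?_⟩
    rw [Multiset.mem_add]
    exact ⟨Or.inr, fun h => h.elim (hsub X) fun h => h⟩
  exact ⟨.contr (Γ + Δ) Δ hc (.weak Γ Δ π), hπ⟩

theorem cut {Γ : Sequent V} {C : Formula V} (hC : C ∈ subformulasOf Γ)
    (h₁ : AnalyticallyProvable (Γ + {r C})) (h₂ : AnalyticallyProvable (Γ + {l C})) :
    AnalyticallyProvable Γ := by
  obtain ⟨π, hπ⟩ := h₁
  obtain ⟨ρ, hρ⟩ := h₂
  obtain ⟨X, hX, hCX⟩ := hC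
  refine mono (Γ := Γ + Γ) ⟨.mcut Γ Γ C 1 1 one_ne_zero one_ne_zero π ρ,
    ⟨X, Multiset.mem_add.2 (Or.inl hX), hCX⟩, hπ, hρ⟩ (by simp)

theorem andL {Γ : Sequent V} {A B : Formula V} (h : AnalyticallyProvable (Γ + {l A, l B})) :
    AnalyticallyProvable (Γ + {l (.and A B)}) :=
  h.elim fun π hπ => ⟨.andL Γ A B π, hπ⟩

theorem andR {Γ : Sequent V} {A B : Formula V} (h₁ : AnalyticallyProvable (Γ + {r A}))
    (h₂ : AnalyticallyProvable (Γ + {r B})) : AnalyticallyProvable (Γ + {r (.and A B)}) :=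
  h₁.elim fun π hπ => h₂.elim fun ρ hρ => ⟨.andR Γ A B π ρ, hπ, hρ⟩

theorem orL {Γ : Sequent V} {A B : Formula V} (h₁ : AnalyticallyProvable (Γ + {l A}))
    (h₂ : AnalyticallyProvable (Γ + {l B})) : AnalyticallyProvable (Γ + {l (.or A B)}) :=
  h₁.elim fun π hπ => h₂.elim fun ρ hρ => ⟨.orL Γ A B π ρ, hπ, hρ⟩

theorem orR {Γ : Sequent V} {A B : Formula V} (h : AnalyticallyProvable (Γ + {r A, r B})) :
    AnalyticallyProvable (Γ + {r (.or A B)}) :=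
  h.elim fun π hπ => ⟨.orR Γ A B π, hπ⟩

theorem impL {Γ : Sequent V} {A B : Formula V} (h₁ : AnalyticallyProvable (Γ + {r A}))
    (h₂ : AnalyticallyProvable (Γ + {l B})) : AnalyticallyProvable (Γ + {l (.imp A B)}) :=
  h₁.elim fun π hπ => h₂.elim fun ρ hρ => ⟨.impL Γ A B π ρ, hπ, hρ⟩

theorem impR {Γ : Sequent V} {A B : Formula V} (h : AnalyticallyProvable (Γ + {l A, r B})) :
    AnalyticallyProvable (Γ + {r (.imp A B)}) :=
  h.elim fun π hπ => ⟨.impR Γ A B π, hπ⟩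

theorem ruleT {Γ : Sequent V} {A : Formula V} (h : AnalyticallyProvable (Γ + {l A})) :
    AnalyticallyProvable (Γ + {l (.box A)}) :=
  h.elim fun π hπ => ⟨.ruleT Γ A π, hπ⟩

theorem rule5 {Γ : Sequent V} {A : Formula V} (hΓ : Boxed Γ)
    (h : AnalyticallyProvable (Γ + {r A})) : AnalyticallyProvable (Γ + {r (.box A)}) :=
  h.elim fun π hπ => ⟨.rule5 Γ A hΓ π, hπ⟩

theorem botL {Γ : Sequent V} (h : l .bot ∈ Γ) : AnalyticallyProvable Γ :=
  mono (Γ := 0 + {l .bot}) ⟨.botL 0, trivial⟩ (by simpa using h)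

/-- Initial sequents on arbitrary formulas. -/
theorem identity (A : Formula V) : ∀ {Γ : Sequent V}, l A ∈ Γ → r A ∈ Γ →
    AnalyticallyProvable Γ := by
  induction A with
  | var x => exact fun hl hr => mono ⟨.id x, trivial⟩ (by simp [hl, hr])
  | bot => exact fun hl _ => botL hl
  | and A B ihA ihB =>
    intro Γ hl hr
    refine mono (andR (Γ := {l (.and A B)}) (A := A) (B := B) ?_ ?_) (by simp [hl, hr])
    · exact mono (andL (Γ := {r A}) (A := A) (B := B) (ihA (by simp) (by simp))) (by simp)
    · exact mono (andL (Γ := {r B}) (A := A) (B := B) (ihB (by simp) (by simp))) (by simp)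
  | or A B ihA ihB =>
    intro Γ hl hr
    refine mono (orL (Γ := {r (.or A B)}) (A := A) (B := B) ?_ ?_) (by simp [hl, hr])
    · exact mono (orR (Γ := {l A}) (A := A) (B := B) (ihA (by simp) (by simp))) (by simp)
    · exact mono (orR (Γ := {l B}) (A := A) (B := B) (ihB (by simp) (by simp))) (by simp)
  | imp A B ihA ihB =>
    intro Γ hl hr
    refine mono (impR (Γ := {l (.imp A B)}) (A := A) (B := B) ?_) (by simp [hl, hr])
    refine mono (impL (Γ := {l A, r B}) (A := A) (B := B) ?_ ?_) (by simp)
    · exact ihA (by simp) (by simp)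
    · exact ihB (by simp) (by simp)
  | box A ihA =>
    intro Γ hl hr
    refine mono (rule5 (Γ := {l (.box A)}) (A := A) (by simp [Boxed, LFormula.formula]) ?_)
      (by simp [hl, hr])
    exact mono (ruleT (Γ := {r A}) (A := A) (ihA (by simp) (by simp))) (by simp)

end AnalyticallyProvable

/-! ### Saturated sequents -/

/-- A sequent without locally analytic proof that contains each of its subformulas on one of its
two sides. -/
structure Saturated (Γ : Sequent V) : Prop where
  not_provable : ¬ AnalyticallyProvable Γ
  mem_or_mem : ∀ C ∈ subformulasOf Γ, l C ∈ Γ ∨ r C ∈ Γ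

theorem exists_saturated {Γ : Sequent V} (h : ¬ AnalyticallyProvable Γ) :
    ∃ Δ, Saturated Δ ∧ (∀ X ∈ Γ, X ∈ Δ) ∧ ∀ X ∈ Δ, X.formula ∈ subformulasOf Γ := by
  have key : ∃ Δ, ¬ AnalyticallyProvable Δ ∧ (∀ X ∈ Γ, X ∈ Δ) ∧
      (∀ X ∈ Δ, X.formula ∈ subformulasOf Γ) ∧ ∀ C ∈ subformulasOf Γ, l C ∈ Δ ∨ r C ∈ Δ := by
    refine Set.Finite.induction_on_subset
      (motive := fun S _ => ∃ Δ, ¬ AnalyticallyProvable Δ ∧ (∀ X ∈ Γ, X ∈ Δ) ∧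
        (∀ X ∈ Δ, X.formula ∈ subformulasOf Γ) ∧ ∀ C ∈ S, l C ∈ Δ ∨ r C ∈ Δ)
      _ (finite_subformulasOf Γ) ?_ ?_
    · exact ⟨Γ, h, fun _ hX => hX, fun X hX => ⟨X, hX, Formula.mem_subformulas_self _⟩,
        fun _ hC => hC.elim⟩
    · rintro C S hC - - ⟨Δ, hΔ, hΓΔ, hsub, hS⟩
      have extend : ∀ Y : LFormula V, Y.formula = C → (Y = l C ∨ Y = r C) →
          ¬ AnalyticallyProvable (Δ + {Y}) →
          ∃ Δ, ¬ AnalyticallyProvable Δ ∧ (∀ X ∈ Γ, X ∈ Δ) ∧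
            (∀ X ∈ Δ, X.formula ∈ subformulasOf Γ) ∧ ∀ D ∈ insert C S, l D ∈ Δ ∨ r D ∈ Δ := by
        intro Y hY hY' hn
        refine ⟨Δ + {Y}, hn, fun X hX => Multiset.mem_add.2 (Or.inl (hΓΔ X hX)),
          fun X hX => ?_, fun D hD => ?_⟩
        · rcases Multiset.mem_add.1 hX with hX | hX
          · exact hsub X hX
          · rw [Multiset.mem_singleton.1 hX, hY]; exact hC
        · rcases hD with rfl | hD
          · rcases hY' with rfl | rfl <;> simp
          · exact (hS D hD).imp (fun h => Multiset.mem_add.2 (Or.inl h))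
              fun h => Multiset.mem_add.2 (Or.inl h)
      by_cases hr : AnalyticallyProvable (Δ + {r C})
      · by_cases hl : AnalyticallyProvable (Δ + {l C})
        · obtain ⟨X, hX, hCX⟩ := hC
          -- The cut on `C` is analytic because its conclusion `Δ` still contains the formula of `Γ`
          -- of which `C` is a subformula.
          exact absurd (.cut ⟨X, hΓΔ X hX, hCX⟩ hr hl) hΔ
        · exact extend (l C) rfl (Or.inl rfl) hl
      · exact extend (r C) rfl (Or.inr rfl) hr
  obtain ⟨Δ, hΔ, hΓΔ, hsub, hS⟩ := key
  refine ⟨Δ, ⟨hΔ, ?_⟩, hΓΔ, hsub⟩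
  -- Only subformulas of `Γ` were added, so `Δ` has no further subformulas left to decide.
  rintro C ⟨X, hX, hC⟩
  exact hS C (subformulasOf_of_mem (hsub X hX) hC)

namespace Saturated

variable {Γ : Sequent V}

theorem not_both (h : Saturated Γ) {A : Formula V} (hl : l A ∈ Γ) (hr : r A ∈ Γ) : False :=
  h.not_provable (.identity A hl hr)

theorem side (h : Saturated Γ) {X : LFormula V} (hX : X ∈ Γ) {C : Formula V}
    (hC : C ∈ X.formula.subformulas) : l C ∈ Γ ∨ r C ∈ Γ :=
  h.mem_or_mem C ⟨X, hX, hC⟩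

end Saturated

/-- The boxed formulas of `Δ` and `Γ` agree on each side. -/
def SameBoxes (Γ Δ : Sequent V) : Prop :=
  ∀ A : Formula V, (l (.box A) ∈ Δ ↔ l (.box A) ∈ Γ) ∧ (r (.box A) ∈ Δ ↔ r (.box A) ∈ Γ)

/-- Read backwards, rule (5) keeps the boxed part of `Γ` and replaces `□A` by `A`; the result is
then saturated. -/
theorem Saturated.exists_box_witness {Γ : Sequent V} (h : Saturated Γ) {A : Formula V}
    (hA : r (.box A) ∈ Γ) : ∃ Δ, Saturated Δ ∧ SameBoxes Γ Δ ∧ r A ∈ Δ := by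
  classical
  set Θ : Sequent V := Γ.filter fun X => ∃ B : Formula V, X.formula = .box B with hΘ
  have hΘΓ : ∀ X ∈ Θ, X ∈ Γ := fun X hX => Multiset.mem_of_mem_filter hX
  have hn : ¬ AnalyticallyProvable (Θ + {r A}) := fun hp =>
    h.not_provable <| (AnalyticallyProvable.rule5
      (fun X hX => (Multiset.mem_filter.1 hX).2) hp).mono fun X hX => by
        rcases Multiset.mem_add.1 hX with hX | hX
        · exact hΘΓ X hX
        · rw [Multiset.mem_singleton.1 hX]; exact hA
  obtain ⟨Δ, hΔ, hsub, hform⟩ := exists_saturated hn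
  have hΘΔ : ∀ X ∈ Θ, X ∈ Δ := fun X hX => hsub X (Multiset.mem_add.2 (Or.inl hX))
  have hl : ∀ B : Formula V, l (.box B) ∈ Γ → l (.box B) ∈ Δ := fun B hB =>
    hΘΔ _ (Multiset.mem_filter.2 ⟨hB, B, rfl⟩)
  have hr : ∀ B : Formula V, r (.box B) ∈ Γ → r (.box B) ∈ Δ := fun B hB =>
    hΘΔ _ (Multiset.mem_filter.2 ⟨hB, B, rfl⟩)
  have hside : ∀ X ∈ Δ, l X.formula ∈ Γ ∨ r X.formula ∈ Γ := by
    intro X hX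
    obtain ⟨Y, hY, hXY⟩ := hform X hX
    rcases Multiset.mem_add.1 hY with hY | hY
    · exact h.side (hΘΓ Y hY) hXY
    · rw [Multiset.mem_singleton.1 hY] at hXY
      exact h.side hA (Or.inr hXY)
  refine ⟨Δ, hΔ, fun B => ⟨⟨fun hB => ?_, hl B⟩, ⟨fun hB => ?_, hr B⟩⟩, hsub _ (by simp)⟩
  · exact (hside _ hB).resolve_right fun h' => hΔ.not_both hB (hr B h')
  · exact (hside _ hB).resolve_left fun h' => hΔ.not_both (hl B h') hB

/-! ### The canonical model -/

/-- The worlds: saturated sequents that agree with `Γ` on boxed formulas. -/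
abbrev World (Γ : Sequent V) := {Δ : Sequent V // Saturated Δ ∧ SameBoxes Γ Δ}

/-- A variable is true at a world if it occurs in the antecedent. -/
def World.val {Γ : Sequent V} (w : World Γ) (x : V) : Prop := l (.var x) ∈ w.1

theorem World.truth {Γ : Sequent V} (A : Formula V) : ∀ w : World Γ,
    (l A ∈ w.1 → Forces World.val w A) ∧ (r A ∈ w.1 → ¬ Forces World.val w A) := by
  induction A with
  | var x => exact fun w => ⟨fun h => h, fun hr hl => w.2.1.not_both hl hr⟩
  | bot => exact fun w => ⟨fun h => w.2.1.not_provable (.botL h), fun _ h => h⟩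
  | and A B ihA ihB =>
    intro w
    have hA : A ∈ (A.and B).subformulas := Or.inr (Or.inl A.mem_subformulas_self)
    have hB : B ∈ (A.and B).subformulas := Or.inr (Or.inr B.mem_subformulas_self)
    refine ⟨fun h => ⟨(ihA w).1 ?_, (ihB w).1 ?_⟩, fun h hf => ?_⟩
    · refine (w.2.1.side h hA).resolve_right fun h' => w.2.1.not_provable ?_
      exact .mono (.andL (Γ := {r A}) (A := A) (B := B) (.identity A (by simp) (by simp)))
        (by simp [h', h])
    · refine (w.2.1.side h hB).resolve_right fun h' => w.2.1.not_provable ?_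
      exact .mono (.andL (Γ := {r B}) (A := A) (B := B) (.identity B (by simp) (by simp)))
        (by simp [h', h])
    · have hlA := (w.2.1.side h hA).resolve_right fun h' => (ihA w).2 h' hf.1
      have hlB := (w.2.1.side h hB).resolve_right fun h' => (ihB w).2 h' hf.2
      exact w.2.1.not_provable <|
        .mono (.andR (Γ := {l A, l B}) (A := A) (B := B)
          (.identity A (by simp) (by simp))
        (.identity B (by simp) (by simp))) (by simp [hlA, hlB, h])
  | or A B ihA ihB =>
    intro w
    have hA : A ∈ (A.or B).subformulas := Or.inr (Or.inl A.mem_subformulas_self)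
    have hB : B ∈ (A.or B).subformulas := Or.inr (Or.inr B.mem_subformulas_self)
    refine ⟨fun h => ?_, fun h hf => hf.elim ((ihA w).2 ?_) ((ihB w).2 ?_)⟩
    · rcases w.2.1.side h hA with h₁ | h₁
      · exact Or.inl ((ihA w).1 h₁)
      rcases w.2.1.side h hB with h₂ | h₂
      · exact Or.inr ((ihB w).1 h₂)
      exact absurd (.mono (.orL (Γ := {r A, r B}) (A := A) (B := B)
        (.identity A (by simp) (by simp))
        (.identity B (by simp) (by simp))) (by simp [h₁, h₂, h])) w.2.1.not_provable
    · refine (w.2.1.side h hA).resolve_left fun h' => w.2.1.not_provable ?_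
      exact .mono (.orR (Γ := {l A}) (A := A) (B := B) (.identity A (by simp) (by simp)))
        (by simp [h', h])
    · refine (w.2.1.side h hB).resolve_left fun h' => w.2.1.not_provable ?_
      exact .mono (.orR (Γ := {l B}) (A := A) (B := B) (.identity B (by simp) (by simp)))
        (by simp [h', h])
  | imp A B ihA ihB =>
    intro w
    have hA : A ∈ (A.imp B).subformulas := Or.inr (Or.inl A.mem_subformulas_self)
    have hB : B ∈ (A.imp B).subformulas := Or.inr (Or.inr B.mem_subformulas_self)
    refine ⟨fun h hf => (ihB w).1 ?_, fun h hf => (ihB w).2 ?_ (hf ((ihA w).1 ?_))⟩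
    · have hlA := (w.2.1.side h hA).resolve_right fun h' => (ihA w).2 h' hf
      refine (w.2.1.side h hB).resolve_right fun h' => w.2.1.not_provable ?_
      exact .mono (.impL (Γ := {l A, r B}) (A := A) (B := B) (.identity A (by simp) (by simp))
        (.identity B (by simp) (by simp))) (by simp [hlA, h', h])
    · refine (w.2.1.side h hB).resolve_left fun h' => w.2.1.not_provable ?_
      exact .mono (.impR (Γ := {l B}) (A := A) (B := B) (.identity B (by simp) (by simp)))
        (by simp [h', h])
    · refine (w.2.1.side h hA).resolve_right fun h' => w.2.1.not_provable ?_
      exact .mono (.impR (Γ := {r A}) (A := A) (B := B) (.identity A (by simp) (by simp)))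
        (by simp [h', h])
  | box A ihA =>
    intro w
    refine ⟨fun h v => (ihA v).1 ?_, fun h hf => ?_⟩
    -- All worlds share their boxes with `Γ`, so `□A` moves from `w` to `v`, where (T) excludes `A`
    -- from the succedent.
    · have hv : l (.box A) ∈ v.1 := (v.2.2 A).1.2 ((w.2.2 A).1.1 h)
      refine (v.2.1.side hv (Or.inr A.mem_subformulas_self)).resolve_right fun h' =>
        v.2.1.not_provable ?_
      exact .mono (.ruleT (Γ := {r A}) (A := A) (.identity A (by simp) (by simp)))
        (by simp [h', hv])
    · obtain ⟨Δ, hΔ, hbox, hr⟩ := w.2.1.exists_box_witness h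
      have hΓΔ : SameBoxes Γ Δ := fun B =>
        ⟨(hbox B).1.trans (w.2.2 B).1, (hbox B).2.trans (w.2.2 B).2⟩
      exact (ihA ⟨Δ, hΔ, hΓΔ⟩).2 hr (hf ⟨Δ, hΔ, hΓΔ⟩)

theorem analyticallyProvable_of_provable {Γ : Sequent V} (h : Provable Γ) :
    AnalyticallyProvable Γ := by
  by_contra hn
  obtain ⟨π⟩ := h
  obtain ⟨Δ, hΔ, hsub, -⟩ := exists_saturated hn
  -- `Δ` itself is the world that refutes every labelled formula of `Γ`.
  let w : World Δ := ⟨Δ, hΔ, fun _ => ⟨Iff.rfl, Iff.rfl⟩⟩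
  obtain ⟨X, hX, hh⟩ := π.sound World.val w
  cases X with
  | l A => exact hh ((World.truth A w).1 (hsub _ hX))
  | r A => exact (World.truth A w).2 (hsub _ hX) hh

end S5

theorem mainTheorem5 (V : Type*) : S5.AnalyticCutProperty V :=
  fun _ h => S5.analyticallyProvable_of_provable h
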